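/- Fix real numbers $\alpha>0$ with $\alpha\neq 1$, $L>0$ and $c>0$. There exist constants $K,K'>0$, depending only on $\alpha,L,c$, such that the following holds. Let $(\mathcal X,\mathcal A)$ be a measurable space, let $P$ be a probability measure on $\mathcal X\times\{0,1\}$, the law of a pair $(X,Y)$, let $\Pi$ be the marginal law of $X$, let $\eta(x)=\mathbb E[Y\mid X=x]$ be a measurable version of the regression function, and let $g_0=\mathbf 1_{\{\eta\ge 1/2\}}$ be the Bayes classifier. Let $\mathscr C$ be a countable collection of measurable subsets of $\mathcal X$ and $\mathcal G=\{\mathbf 1_C:C\in\mathscr C\}$, and suppose that $g_0\in\mathcal G$. For $g\in\mathcal G$ let $$\mathcal E_P(g)=P(Y\neq g(X))-\inf_{g'\in\mathcal G}P(Y\neq g'(X))$$ be its excess risk. For $\epsilon>0$ let $\mathcal N_I(\epsilon,\mathscr C,\Pi)$ be the $L_1(\Pi)$-bracketing number of $\mathcal G$, that is, the smallest number of brackets $[\ell,u]=\{f:\ell\le f\le u\}$, with $\ell,u:\mathcal X\to\mathbb R$ measurable and $\Pi$-integrable and $\int|u-\ell|\,d\Pi<\epsilon$, whose union contains $\mathcal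 G$. Suppose that (i) (entropy condition) $\log\mathcal N_I(\epsilon,\mathscr C,\Pi)\le L\epsilon^{-\alpha}$ for all $\epsilon>0$; (ii) (Tsybakov's margin condition with $\kappa=1$) $\mathcal E_P(g)\ge c\,\Pi(g(X)\neq g_0(X))$ for all $g\in\mathcal G$. Let $n\ge 1$, let $(X_1,Y_1),\ldots,(X_n,Y_n)$ be i.i.d. with law $P$, and let $\widehat g_n\in\mathcal G$ be any empirical risk minimizer, $$\widehat g_n\in\operatorname*{arg\,min}_{g\in\mathcal G}\frac1n\sum_{i=1}^n\mathbf 1_{\{Y_i\neq g(X_i)\}}.$$ If $r_n^2\ge K n^{-1/(\alpha+1)}$, then $$\mathbb P\big(\mathcal E_P(\widehat g_n)\ge r_n^2\big)\le K'\exp(-n r_n^2/K').$$ -/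

import Mathlib

open MeasureTheory ProbabilityTheory

noncomputable section

namespace BinaryClassification

variable {𝒳 : Type*}

/-- The pair `b = (l, u)` is an `ε`-bracket in `L₁(Q)`: the end points are measurable and
`Q`-integrable (they need not belong to any given class) and `‖u - l‖_{L₁(Q)} < ε`. -/
def IsL1Bracket [MeasurableSpace 𝒳] (Q : Measure 𝒳) (ε : ℝ)
    (b : (𝒳 → ℝ) × (𝒳 → ℝ)) : Prop :=
  Measurable b.1 ∧ Measurable b.2 ∧ Integrable b.1 Q ∧ Integrable b.2 Q ∧
    ∫ x, |b.2 x - b.1 x| ∂Q < ε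

/-- The bracketing number `N_[](ε, F, L₁(Q))`: the least cardinality of a family of `ε`-brackets
in `L₁(Q)` that covers `F` (equal to `⊤` if no finite family does). -/
def bracketingNumber [MeasurableSpace 𝒳] (Q : Measure 𝒳) (ε : ℝ) (F : Set (𝒳 → ℝ)) : ℕ∞ :=
  sInf {N : ℕ∞ | ∃ B : Set ((𝒳 → ℝ) × (𝒳 → ℝ)), B.encard = N ∧
    (∀ b ∈ B, IsL1Bracket Q ε b) ∧
    ∀ f ∈ F, ∃ b ∈ B, (∀ x, b.1 x ≤ f x) ∧ (∀ x, f x ≤ b.2 x)}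

/-- `N_I(ε, 𝒞, Q)`: the `L₁(Q)`-bracketing number of the indicators of the sets in `𝒞`. -/
def setBracketingNumber [MeasurableSpace 𝒳] (Q : Measure 𝒳) (ε : ℝ) (𝒞 : Set (Set 𝒳)) : ℕ∞ :=
  bracketingNumber Q ε ((fun C : Set 𝒳 => C.indicator (fun _ => (1 : ℝ))) '' 𝒞)

/-- `log N_I(ε, 𝒞, Q) ≤ L ε^{-α}` for all `ε > 0` (extended-real logarithm, `log ∞ = ∞`). -/
def EntropyBound [MeasurableSpace 𝒳] (Q : Measure 𝒳) (𝒞 : Set (Set 𝒳)) (L α : ℝ) : Prop :=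
  ∀ ε : ℝ, 0 < ε →
    ENNReal.log (setBracketingNumber Q ε 𝒞 : ENNReal) ≤ ((L * ε ^ (-α) : ℝ) : EReal)

/-- The classifier `g = 1_C`, with values in the set of labels `{0, 1}`. -/
def classifier (C : Set 𝒳) : 𝒳 → Fin 2 := C.indicator (fun _ => 1)

/-- The generalization error `P(Y ≠ g(X))` of `g = 1_C`, for `(X, Y)` with law `P`. -/
def genError [MeasurableSpace 𝒳] (P : Measure (𝒳 × Fin 2)) (C : Set 𝒳) : ℝ :=
  P.real {z | z.2 ≠ classifier C z.1}

/-- The excess risk `P(Y ≠ g(X)) - inf_{g' ∈ 𝒢} P(Y ≠ g'(X))` of `g = 1_C` over the class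
`𝒢 = {1_{C'} : C' ∈ 𝒞}`. -/
def excessRisk [MeasurableSpace 𝒳] (P : Measure (𝒳 × Fin 2)) (𝒞 : Set (Set 𝒳))
    (C : Set 𝒳) : ℝ :=
  genError P C - sInf (genError P '' 𝒞)

/-- `η` is a (measurable) version of the regression function `x ↦ E[Y | X = x]` under `P`. -/
def IsRegressionFunction [m : MeasurableSpace 𝒳] (P : Measure (𝒳 × Fin 2)) (η : 𝒳 → ℝ) : Prop :=
  Measurable η ∧
    (fun z : 𝒳 × Fin 2 => η z.1) =ᵐ[P]
      P[(fun z : 𝒳 × Fin 2 => ((z.2 : ℕ) : ℝ)) | m.comap Prod.fst]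

/-- The set `{x : η(x) ≥ 1/2}` whose indicator is the Bayes classifier `g₀`. -/
def bayesSet (η : 𝒳 → ℝ) : Set 𝒳 := {x | 1 / 2 ≤ η x}

/-- The margin condition with `κ = 1` and constant `c`: every `g ∈ 𝒢` satisfies
`ℰ_P(g) ≥ c Π(g ≠ g₀)`, where `Π` is the marginal law of `X` and `g₀ = 1_{C₀}`. -/
def MarginCondition [MeasurableSpace 𝒳] (P : Measure (𝒳 × Fin 2)) (𝒞 : Set (Set 𝒳))
    (C₀ : Set 𝒳) (c : ℝ) : Prop :=
  ∀ C ∈ 𝒞, c * P.fst.real {x | classifier C x ≠ classifier C₀ x} ≤ excessRisk P 𝒞 C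

/-- The training error `n⁻¹ ∑ᵢ 1{Yᵢ ≠ g(Xᵢ)}` of `g = 1_C` on the sample `z`. -/
def empError {n : ℕ} (z : Fin n → 𝒳 × Fin 2) (C : Set 𝒳) : ℝ :=
  (1 / (n : ℝ)) * ∑ i, if (z i).2 ≠ classifier C (z i).1 then 1 else 0

/-- `1_C` is an empirical risk minimizer over `{1_{C'} : C' ∈ 𝒞}` for the sample `z`. -/
def IsERM {n : ℕ} (𝒞 : Set (Set 𝒳)) (z : Fin n → 𝒳 × Fin 2) (C : Set 𝒳) : Prop :=
  C ∈ 𝒞 ∧ ∀ C' ∈ 𝒞, empError z C ≤ empError z C'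

end BinaryClassification

end

namespace BinaryClassification

variable {𝒳 : Type*} [MeasurableSpace 𝒳]

/-! A single-scale bracketing argument suffices; no chaining is needed. Put `s = r ^ 2` and cover
the class by brackets of width below `s / 2`. A bracket around a classifier of excess risk `e ≥ s`
yields a function lying below the loss difference with the Bayes classifier, with mean at least `e -
s / 2 ≥ e / 2`. The margin condition bounds its second moment by a multiple of `e`, hence of its
mean, so a Chernoff bound with a fixed parameter `t` makes its empirical sum positive outside
probability `exp (-n t s / 4)` (`measureReal_sum_lowerLoss_nonpos_le`). An empirical risk minimizer
in that bracket forces the sum to be nonpositive. A union bound costs `exp (L (s / 2) ^ (-α))`,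
which above the critical radius is at most `exp (n t s / 8)` (`entropy_le_of_critical`). -/

/-- A one-sided Chernoff bound for sums of i.i.d. variables whose second moment is controlled by
their mean. -/
lemma measureReal_sum_nonpos_le {E Ω : Type*} [MeasurableSpace E] [MeasurableSpace Ω]
    {P : Measure E} [IsProbabilityMeasure P] {μ : Measure Ω} [IsProbabilityMeasure μ] {n : ℕ}
    {Z : Fin n → Ω → E} (hZ : ∀ i, Measurable (Z i)) (hlaw : ∀ i, μ.map (Z i) = P)
    (hind : iIndepFun Z μ) {h : E → ℝ} (hm : Measurable h) (hb : ∀ z, |h z| ≤ 1)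
    {t : ℝ} (ht0 : 0 ≤ t) (ht1 : t ≤ 1) (hv : t * ∫ z, h z ^ 2 ∂P ≤ (∫ z, h z ∂P) / 2) :
    μ.real {ω | ∑ i, h (Z i ω) ≤ 0} ≤ Real.exp (-(n * (t * (∫ z, h z ∂P) / 2))) := by
  have hint : Integrable h P :=
    Integrable.of_bound hm.aestronglyMeasurable 1 (.of_forall fun z => by simpa using hb z)
  have hint2 : Integrable (fun z => h z ^ 2) P :=
    Integrable.of_bound (hm.pow_const 2).aestronglyMeasurable 1 (.of_forall fun z => by
      simpa using hb z)
  have hpt : ∀ z, Real.exp (t * -h z) ≤ 1 - t * h z + t ^ 2 * h z ^ 2 := fun z => by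
    have hx : |t * -h z| ≤ 1 := by
      rw [abs_mul, abs_neg, abs_of_nonneg ht0]
      exact mul_le_one₀ ht1 (abs_nonneg _) (hb z)
    have := (abs_le.mp (Real.abs_exp_sub_one_sub_id_le hx)).2
    nlinarith
  have hexp : Measurable fun z => Real.exp (t * -h z) := by fun_prop
  have hmgf : ∫ z, Real.exp (t * -h z) ∂P ≤ Real.exp (-(t * (∫ z, h z ∂P) / 2)) := by
    calc ∫ z, Real.exp (t * -h z) ∂P ≤ ∫ z, (1 - t * h z + t ^ 2 * h z ^ 2) ∂P := by
          refine integral_mono_of_nonneg (.of_forall fun z => (Real.exp_pos _).le) ?_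
            (.of_forall hpt)
          exact ((integrable_const _).sub (hint.const_mul t)).add (hint2.const_mul _)
      _ = 1 - t * ∫ z, h z ∂P + t ^ 2 * ∫ z, h z ^ 2 ∂P := by
          rw [integral_add (by exact (integrable_const _).sub (hint.const_mul t))
            (hint2.const_mul _), integral_sub (integrable_const _) (hint.const_mul t),
            integral_const_mul, integral_const_mul]
          simp
      -- By `hv` the quadratic term eats at most half of the linear one.
      _ ≤ -(t * (∫ z, h z ∂P) / 2) + 1 := by nlinarith
      _ ≤ _ := Real.add_one_le_exp _
  have hindep : iIndepFun (fun i ω => -h (Z i ω)) μ :=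
    hind.comp (fun _ z => -h z) fun _ => hm.neg
  have hmeas : ∀ i, Measurable fun ω => -h (Z i ω) := fun i => (hm.comp (hZ i)).neg
  have hone : ∀ i, mgf (fun ω => -h (Z i ω)) μ t ≤ Real.exp (-(t * (∫ z, h z ∂P) / 2)) := fun i => by
    rw [← hlaw i] at hmgf ⊢
    rw [integral_map (hZ i).aemeasurable hexp.aestronglyMeasurable] at hmgf
    exact hmgf
  have hsumint : Integrable (fun ω => Real.exp (t * (∑ i, fun ω => -h (Z i ω)) ω)) μ := by
    refine Integrable.of_bound (C := Real.exp n) ?_ (.of_forall fun ω => ?_)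
    · have : Measurable (∑ i, fun ω => -h (Z i ω)) := by
        fun_prop
      exact (this.const_mul t).exp.aestronglyMeasurable
    · rw [Real.norm_eq_abs, Real.abs_exp, Real.exp_le_exp, Finset.sum_apply]
      have h1 : ∑ i, -h (Z i ω) ≤ (n : ℝ) := by
        calc ∑ i, -h (Z i ω) ≤ ∑ _i : Fin n, (1 : ℝ) :=
              Finset.sum_le_sum fun i _ => (neg_le_abs _).trans (hb _)
          _ = n := by simp
      have hn : (0 : ℝ) ≤ n := Nat.cast_nonneg n
      nlinarith
  have hchern := measure_ge_le_exp_mul_mgf (μ := μ) (X := ∑ i, fun ω => -h (Z i ω)) 0 ht0 hsumint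
  rw [hindep.mgf_sum hmeas] at hchern
  calc μ.real {ω | ∑ i, h (Z i ω) ≤ 0}
      = μ.real {ω | 0 ≤ (∑ i, fun ω => -h (Z i ω)) ω} := by simp
    _ ≤ ∏ i : Fin n, mgf (fun ω => -h (Z i ω)) μ t := by simpa using hchern
    _ ≤ ∏ _i : Fin n, Real.exp (-(t * (∫ z, h z ∂P) / 2)) :=
        Finset.prod_le_prod (fun _ _ => mgf_nonneg) fun i _ => hone i
    _ = _ := by rw [Finset.prod_const, ← Real.exp_nat_mul]; simp

lemma EntropyBound.exists_finset {Q : Measure 𝒳} {𝒞 : Set (Set 𝒳)} {L α : ℝ}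
    (h : EntropyBound Q 𝒞 L α) {ε : ℝ} (hε : 0 < ε) :
    ∃ B : Finset ((𝒳 → ℝ) × (𝒳 → ℝ)), (B.card : ℝ) ≤ Real.exp (L * ε ^ (-α)) ∧
      (∀ b ∈ B, IsL1Bracket Q ε b) ∧
      ∀ C ∈ 𝒞, ∃ b ∈ B, (∀ x, b.1 x ≤ C.indicator (fun _ => (1 : ℝ)) x) ∧
        (∀ x, C.indicator (fun _ => (1 : ℝ)) x ≤ b.2 x) := by
  have hlog := h ε hε
  have hle : (setBracketingNumber Q ε 𝒞 : ENNReal) ≤ ENNReal.ofReal (Real.exp (L * ε ^ (-α))) := by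
    rw [← EReal.exp_coe, ← ENNReal.log_le_log_iff, EReal.log_exp]
    exact hlog
  have hne : setBracketingNumber Q ε 𝒞 ≠ ⊤ := by
    intro htop
    rw [htop] at hle
    simp at hle
  have hset : {N : ℕ∞ | ∃ B : Set ((𝒳 → ℝ) × (𝒳 → ℝ)), B.encard = N ∧
      (∀ b ∈ B, IsL1Bracket Q ε b) ∧
      ∀ f ∈ (fun C : Set 𝒳 => C.indicator (fun _ => (1 : ℝ))) '' 𝒞,
        ∃ b ∈ B, (∀ x, b.1 x ≤ f x) ∧ (∀ x, f x ≤ b.2 x)}.Nonempty := by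
    -- In `ℕ∞` the infimum of the empty set is `⊤`, so a finite bracketing number is attained by an
    -- actual cover.
    by_contra hempty
    rw [Set.not_nonempty_iff_eq_empty] at hempty
    exact hne (by rw [setBracketingNumber, bracketingNumber, hempty, sInf_empty])
  obtain ⟨B, hcard, hB, hcov⟩ := csInf_mem hset
  change B.encard = setBracketingNumber Q ε 𝒞 at hcard
  have hfin : B.Finite := Set.encard_ne_top_iff.mp (hcard ▸ hne)
  refine ⟨hfin.toFinset, ?_, by simpa using hB, fun C hC => ?_⟩
  · rw [← hcard, hfin.encard_eq_coe_toFinset_card] at hle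
    rw [← ENNReal.ofReal_le_ofReal_iff (Real.exp_pos _).le, ENNReal.ofReal_natCast]
    simpa using hle
  · obtain ⟨b, hb, h1, h2⟩ := hcov _ ⟨C, hC, rfl⟩
    exact ⟨b, by simpa using hb, h1, h2⟩

/-! ### Misclassification loss and risk -/

/-- The misclassification loss `1{y ≠ 1_C(x)}`. -/
noncomputable def loss (C : Set 𝒳) (z : 𝒳 × Fin 2) : ℝ := if z.2 ≠ classifier C z.1 then 1 else 0

lemma measurable_classifier {C : Set 𝒳} (hC : MeasurableSet C) : Measurable (classifier C) :=
  measurable_const.indicator hC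

lemma measurableSet_loss {C : Set 𝒳} (hC : MeasurableSet C) :
    MeasurableSet {z : 𝒳 × Fin 2 | z.2 ≠ classifier C z.1} :=
  (measurableSet_eq_fun measurable_snd ((measurable_classifier hC).comp measurable_fst)).compl

lemma measurable_loss {C : Set 𝒳} (hC : MeasurableSet C) : Measurable (loss C) :=
  Measurable.ite (measurableSet_loss hC) measurable_const measurable_const

lemma abs_loss_le_one {𝒳 : Type*} (C : Set 𝒳) (z : 𝒳 × Fin 2) : |loss C z| ≤ 1 := by
  unfold loss; split_ifs <;> simp

lemma integrable_loss {P : Measure (𝒳 × Fin 2)} [IsFiniteMeasure P] {C : Set 𝒳}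
    (hC : MeasurableSet C) : Integrable (loss C) P :=
  Integrable.of_bound (measurable_loss hC).aestronglyMeasurable 1
    (.of_forall fun z => by simpa using abs_loss_le_one C z)

lemma integral_loss (P : Measure (𝒳 × Fin 2)) {C : Set 𝒳} (hC : MeasurableSet C) :
    ∫ z, loss C z ∂P = genError P C := by
  rw [genError, ← integral_indicator_one (measurableSet_loss hC)]
  congr 1
  ext z
  simp [loss, Set.indicator_apply]

lemma integral_abs_loss_sub_le (P : Measure (𝒳 × Fin 2)) [IsFiniteMeasure P] {C D : Set 𝒳}
    (hC : MeasurableSet C) (hD : MeasurableSet D) :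
    ∫ z, |loss C z - loss D z| ∂P ≤ P.fst.real {x | classifier C x ≠ classifier D x} := by
  have hS : MeasurableSet {x | classifier C x ≠ classifier D x} :=
    (measurableSet_eq_fun (measurable_classifier hC) (measurable_classifier hD)).compl
  rw [Measure.real, Measure.fst_apply hS, ← Measure.real,
    ← integral_indicator_one (measurable_fst hS)]
  refine integral_mono_of_nonneg (.of_forall fun z => abs_nonneg _)
    ((integrable_const _).indicator (measurable_fst hS)) (.of_forall fun z => ?_)
  by_cases hz : classifier C z.1 = classifier D z.1
  · simp [loss, hz]
  · have : z ∈ Prod.fst ⁻¹' {x | classifier C x ≠ classifier D x} := by simpa using hz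
    rw [Set.indicator_of_mem this]
    simp only [loss]
    split_ifs <;> simp

/-- Under the margin condition, the reference classifier minimizes the risk over the class. -/
lemma MarginCondition.excessRisk_eq {P : Measure (𝒳 × Fin 2)} [IsFiniteMeasure P]
    {𝒞 : Set (Set 𝒳)} {C₀ : Set 𝒳} {c : ℝ} (h : MarginCondition P 𝒞 C₀ c) (hc : 0 < c)
    (hmeas : ∀ C ∈ 𝒞, MeasurableSet C) (h₀ : C₀ ∈ 𝒞) (C : Set 𝒳) :
    excessRisk P 𝒞 C = genError P C - genError P C₀ := by
  have hbdd : BddBelow (genError P '' 𝒞) :=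
    ⟨0, by rintro _ ⟨C, -, rfl⟩; exact measureReal_nonneg⟩
  have hle : genError P C₀ ≤ sInf (genError P '' 𝒞) := by
    refine le_of_forall_pos_le_add fun δ hδ => ?_
    -- A `δ'`-minimizer `D` has excess risk below `δ'`, so the margin puts it within `δ' / c` of
    -- `C₀`; the risk of `C₀` is then within `δ' (1 + 1 / c) = δ` of the infimum.
    have hδ' : 0 < δ / (1 + 1 / c) := by positivity
    obtain ⟨_, ⟨D, hD, rfl⟩, hlt⟩ :=
      Real.lt_sInf_add_pos (Set.Nonempty.image (genError P) ⟨C₀, h₀⟩) hδ'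
    have hm := h D hD
    have hi := integral_abs_loss_sub_le P (hmeas D hD) (hmeas _ h₀)
    have hdiff : genError P C₀ - genError P D ≤ ∫ z, |loss D z - loss C₀ z| ∂P := by
      rw [← integral_loss P (hmeas D hD), ← integral_loss P (hmeas _ h₀),
        ← integral_sub (integrable_loss (hmeas _ h₀)) (integrable_loss (hmeas D hD))]
      refine integral_mono ((integrable_loss (hmeas _ h₀)).sub (integrable_loss (hmeas D hD)))
        ((integrable_loss (hmeas D hD)).sub (integrable_loss (hmeas _ h₀))).abs fun z => ?_
      simpa using neg_le_abs (loss D z - loss C₀ z)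
    rw [excessRisk] at hm
    have h1 : P.fst.real {x | classifier D x ≠ classifier C₀ x} ≤ δ / (1 + 1 / c) / c := by
      rw [le_div_iff₀ hc]; linarith
    have h2 : δ / (1 + 1 / c) + δ / (1 + 1 / c) / c = δ := by field_simp
    linarith
  rw [excessRisk, le_antisymm (csInf_le hbdd ⟨C₀, h₀, rfl⟩) hle]

/-! ### Lower losses built from brackets -/

/-- The lower bound on `loss C - loss C₀` furnished by a bracket `b` around `1_C`. -/
noncomputable def lowerLoss (b : (𝒳 → ℝ) × (𝒳 → ℝ)) (C₀ : Set 𝒳) (z : 𝒳 × Fin 2) : ℝ :=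
  (if z.2 = 0 then max (b.1 z.1) 0 else 1 - min (b.2 z.1) 1) - loss C₀ z

lemma measurable_lowerLoss {b : (𝒳 → ℝ) × (𝒳 → ℝ)} {C₀ : Set 𝒳} (h1 : Measurable b.1)
    (h2 : Measurable b.2) (h₀ : MeasurableSet C₀) : Measurable (lowerLoss b C₀) := by
  refine Measurable.sub (Measurable.ite (measurable_snd (measurableSet_singleton 0)) ?_ ?_)
    (measurable_loss h₀)
  · exact (h1.comp measurable_fst).max measurable_const
  · exact measurable_const.sub ((h2.comp measurable_fst).min measurable_const)

lemma loss_eq {𝒳 : Type*} (C : Set 𝒳) (z : 𝒳 × Fin 2) :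
    loss C z = if z.2 = 0 then C.indicator (fun _ => (1 : ℝ)) z.1
      else 1 - C.indicator (fun _ => (1 : ℝ)) z.1 := by
  obtain ⟨x, y⟩ := z
  by_cases hx : x ∈ C <;> fin_cases y <;> simp [loss, classifier, hx]

lemma lowerLoss_le {𝒳 : Type*} {b : (𝒳 → ℝ) × (𝒳 → ℝ)} {C : Set 𝒳}
    (h1 : ∀ x, b.1 x ≤ C.indicator (fun _ => (1 : ℝ)) x)
    (h2 : ∀ x, C.indicator (fun _ => (1 : ℝ)) x ≤ b.2 x) (C₀ : Set 𝒳) (z : 𝒳 × Fin 2) :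
    lowerLoss b C₀ z ≤ loss C z - loss C₀ z := by
  have h0 : (0 : ℝ) ≤ C.indicator (fun _ => (1 : ℝ)) z.1 :=
    Set.indicator_nonneg (fun _ _ => zero_le_one) _
  have h3 : C.indicator (fun _ => (1 : ℝ)) z.1 ≤ 1 :=
    Set.indicator_le_self' (fun _ _ => zero_le_one) _
  rw [lowerLoss, loss_eq C]
  split_ifs
  · linarith [max_le (h1 z.1) h0]
  · linarith [le_min (h2 z.1) h3]

lemma loss_sub_le_lowerLoss_add {𝒳 : Type*} {b : (𝒳 → ℝ) × (𝒳 → ℝ)} {C : Set 𝒳}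
    (h1 : ∀ x, b.1 x ≤ C.indicator (fun _ => (1 : ℝ)) x)
    (h2 : ∀ x, C.indicator (fun _ => (1 : ℝ)) x ≤ b.2 x) (C₀ : Set 𝒳) (z : 𝒳 × Fin 2) :
    loss C z - loss C₀ z ≤ lowerLoss b C₀ z + |b.2 z.1 - b.1 z.1| := by
  rw [lowerLoss, loss_eq C]
  have := le_abs_self (b.2 z.1 - b.1 z.1)
  split_ifs
  · linarith [le_max_left (b.1 z.1) 0, h2 z.1]
  · linarith [min_le_left (b.2 z.1) 1, h1 z.1]

/-- Bracket end points may be unbounded; clipping them at `0` and `1` is what gives this bound. -/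
lemma abs_lowerLoss_le_one {𝒳 : Type*} {b : (𝒳 → ℝ) × (𝒳 → ℝ)} {C : Set 𝒳}
    (h1 : ∀ x, b.1 x ≤ C.indicator (fun _ => (1 : ℝ)) x)
    (h2 : ∀ x, C.indicator (fun _ => (1 : ℝ)) x ≤ b.2 x) (C₀ : Set 𝒳) (z : 𝒳 × Fin 2) :
    |lowerLoss b C₀ z| ≤ 1 := by
  have h0 : (0 : ℝ) ≤ C.indicator (fun _ => (1 : ℝ)) z.1 :=
    Set.indicator_nonneg (fun _ _ => zero_le_one) _
  have h3 : C.indicator (fun _ => (1 : ℝ)) z.1 ≤ 1 :=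
    Set.indicator_le_self' (fun _ _ => zero_le_one) _
  have hl0 : 0 ≤ loss C₀ z := by unfold loss; split_ifs <;> simp
  have hl1 : loss C₀ z ≤ 1 := (le_abs_self _).trans (abs_loss_le_one C₀ z)
  rw [lowerLoss, abs_le]
  split_ifs
  · have := max_le ((h1 z.1).trans h3) zero_le_one
    constructor <;> linarith [le_max_right (b.1 z.1) 0]
  · have := le_min (h0.trans (h2 z.1)) zero_le_one
    constructor <;> linarith [min_le_right (b.2 z.1) 1]

/-- A bracket around a classifier of excess risk at least `s` furnishes a lower loss whose
empirical sum is positive outside an event of exponentially small probability. -/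
lemma measureReal_sum_lowerLoss_nonpos_le {Ω : Type*} [MeasurableSpace Ω]
    {P : Measure (𝒳 × Fin 2)} [IsProbabilityMeasure P] {μ : Measure Ω} [IsProbabilityMeasure μ]
    {n : ℕ} {Z : Fin n → Ω → 𝒳 × Fin 2} (hZ : ∀ i, Measurable (Z i))
    (hlaw : ∀ i, μ.map (Z i) = P) (hind : iIndepFun Z μ) {C C₀ : Set 𝒳} (hC : MeasurableSet C)
    (h₀ : MeasurableSet C₀) {b : (𝒳 → ℝ) × (𝒳 → ℝ)} {s c t : ℝ} (hc : 0 < c)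
    (hb : IsL1Bracket P.fst (s / 2) b)
    (h1 : ∀ x, b.1 x ≤ C.indicator (fun _ => (1 : ℝ)) x)
    (h2 : ∀ x, C.indicator (fun _ => (1 : ℝ)) x ≤ b.2 x)
    (hs : s ≤ genError P C - genError P C₀)
    (hmargin : c * P.fst.real {x | classifier C x ≠ classifier C₀ x} ≤
      genError P C - genError P C₀)
    (ht0 : 0 ≤ t) (ht1 : t ≤ 1) (ht : t * (1 / c + 1 / 2) ≤ 1 / 4) :
    μ.real {ω | ∑ i, lowerLoss b C₀ (Z i ω) ≤ 0} ≤ Real.exp (-(n * (t * s / 4))) := by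
  obtain ⟨hb1, hb2, hi1, hi2, hbr⟩ := hb
  set e := genError P C - genError P C₀ with he
  have hm := measurable_lowerLoss hb1 hb2 h₀
  have habs := abs_lowerLoss_le_one h1 h2 C₀
  have hiLow : Integrable (lowerLoss b C₀) P :=
    Integrable.of_bound hm.aestronglyMeasurable 1 (.of_forall fun z => by simpa using habs z)
  have hiDiff : Integrable (fun z => loss C z - loss C₀ z) P :=
    (integrable_loss hC).sub (integrable_loss h₀)
  have hiWidth : Integrable (fun z : 𝒳 × Fin 2 => |b.2 z.1 - b.1 z.1|) P :=
    (hi2.sub hi1).abs.comp_measurable measurable_fst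
  have hwidth : ∫ z, |b.2 z.1 - b.1 z.1| ∂P < s / 2 := by
    have habs_meas : Measurable fun x => |b.2 x - b.1 x| := (hb2.sub hb1).abs
    rwa [Measure.fst, integral_map measurable_fst.aemeasurable
      habs_meas.aestronglyMeasurable] at hbr
  have hdiff : ∫ z, (loss C z - loss C₀ z) ∂P = e := by
    rw [integral_sub (integrable_loss hC) (integrable_loss h₀), integral_loss P hC,
      integral_loss P h₀]
  have hmean : e ≤ ∫ z, lowerLoss b C₀ z ∂P + ∫ z, |b.2 z.1 - b.1 z.1| ∂P := by
    rw [← hdiff, ← integral_add hiLow hiWidth]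
    exact integral_mono hiDiff (hiLow.add hiWidth) (loss_sub_le_lowerLoss_add h1 h2 C₀)
  -- A function bounded by one has square at most its absolute value, and the lower loss is within
  -- the bracket width of the loss difference.
  have hsq : ∫ z, lowerLoss b C₀ z ^ 2 ∂P ≤
      ∫ z, |loss C z - loss C₀ z| ∂P + ∫ z, |b.2 z.1 - b.1 z.1| ∂P := by
    rw [← integral_add hiDiff.abs hiWidth]
    refine integral_mono_of_nonneg (.of_forall fun z => sq_nonneg _) (hiDiff.abs.add hiWidth)
      (.of_forall fun z => ?_)
    have hsq' : lowerLoss b C₀ z ^ 2 ≤ |lowerLoss b C₀ z| := by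
      rw [← sq_abs]
      nlinarith [abs_nonneg (lowerLoss b C₀ z), habs z]
    have hlow : |lowerLoss b C₀ z| ≤ |loss C z - loss C₀ z| + |b.2 z.1 - b.1 z.1| := by
      have h3 := lowerLoss_le h1 h2 C₀ z
      have h4 := loss_sub_le_lowerLoss_add h1 h2 C₀ z
      have h5 := abs_le.mp (le_refl |loss C z - loss C₀ z|)
      rw [abs_le]
      constructor <;> linarith [abs_nonneg (b.2 z.1 - b.1 z.1)]
    exact hsq'.trans hlow
  have hL1 : ∫ z, |loss C z - loss C₀ z| ∂P ≤ e * (1 / c) := by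
    rw [mul_one_div, le_div_iff₀ hc, mul_comm]
    exact (mul_le_mul_of_nonneg_left (integral_abs_loss_sub_le P hC h₀) hc.le).trans hmargin
  have hspos : 0 ≤ s := by
    have : 0 ≤ ∫ z, |b.2 z.1 - b.1 z.1| ∂P := integral_nonneg fun _ => abs_nonneg _
    linarith
  -- The width is below `s / 2 ≤ e / 2`: the second moment is at most `e (1 / c + 1 / 2)` and the
  -- mean at least `e / 2`.
  have hv : t * ∫ z, lowerLoss b C₀ z ^ 2 ∂P ≤ (∫ z, lowerLoss b C₀ z ∂P) / 2 := by
    calc t * ∫ z, lowerLoss b C₀ z ^ 2 ∂P ≤ t * (e * (1 / c + 1 / 2)) :=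
          mul_le_mul_of_nonneg_left (by linarith) ht0
      _ = (t * (1 / c + 1 / 2)) * e := by ring
      _ ≤ 1 / 4 * e := mul_le_mul_of_nonneg_right ht (hspos.trans hs)
      _ ≤ _ := by linarith
  refine (measureReal_sum_nonpos_le hZ hlaw hind hm habs ht0 ht1 hv).trans
    (Real.exp_le_exp.mpr (neg_le_neg (mul_le_mul_of_nonneg_left ?_ (Nat.cast_nonneg n))))
  have : s / 2 ≤ ∫ z, lowerLoss b C₀ z ∂P := by linarith
  nlinarith [mul_le_mul_of_nonneg_left this ht0]

lemma IsERM.sum_loss_le {𝒳 : Type*} {n : ℕ} {𝒞 : Set (Set 𝒳)} {z : Fin n → 𝒳 × Fin 2}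
    {C : Set 𝒳} (h : IsERM 𝒞 z C) (hn : 1 ≤ n) {C' : Set 𝒳} (hC' : C' ∈ 𝒞) :
    ∑ i, loss C (z i) ≤ ∑ i, loss C' (z i) := by
  have hn' : (0 : ℝ) < 1 / n := by
    have : (0 : ℝ) < n := by exact_mod_cast hn
    positivity
  exact le_of_mul_le_mul_left (h.2 C' hC') hn'

/-- With `s` above the critical level `n ^ (-1 / (α + 1))`, the entropy at scale `s / 2` is
dominated by the exponent `n s`. -/
lemma entropy_le_of_critical {α L t : ℝ} (hα : 0 < α) (hL : 0 < L) (ht : 0 < t) {n : ℕ}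
    (hn : 1 ≤ n) {s : ℝ}
    (hs : (8 * L * 2 ^ α / t) ^ (1 / (α + 1)) * (n : ℝ) ^ (-1 / (α + 1)) ≤ s) :
    0 < s ∧ L * (s / 2) ^ (-α) ≤ n * (t * s / 8) := by
  have hn' : (0 : ℝ) < n := by exact_mod_cast hn
  have hα1 : 0 < α + 1 := by linarith
  -- The desired inequality rearranges to `A / n ≤ s ^ (α + 1)`.
  set A := 8 * L * 2 ^ α / t with hA
  have hApos : 0 < A := by positivity
  have hs0 : 0 < s := lt_of_lt_of_le (by positivity) hs
  refine ⟨hs0, ?_⟩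
  have hpow : A * (n : ℝ)⁻¹ ≤ s ^ α * s := by
    have h1 := Real.rpow_le_rpow (by positivity) hs hα1.le
    rw [Real.mul_rpow (by positivity) (by positivity), ← Real.rpow_mul hApos.le,
      ← Real.rpow_mul hn'.le, div_mul_cancel₀ _ hα1.ne', div_mul_cancel₀ _ hα1.ne',
      Real.rpow_one, Real.rpow_neg_one, Real.rpow_add hs0, Real.rpow_one] at h1
    exact h1
  have hsα : 0 < s ^ α := by positivity
  rw [Real.rpow_neg (by positivity), Real.div_rpow hs0.le zero_le_two, inv_div, ← mul_div_assoc,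
    div_le_iff₀ hsα]
  rw [← div_eq_mul_inv, div_le_iff₀ hn', hA, div_le_iff₀ ht] at hpow
  linarith

end BinaryClassification

theorem theorem6 (α L c : ℝ) (hα : 0 < α) (hα1 : α ≠ 1) (hL : 0 < L) (hc : 0 < c) :
    ∃ K : ℝ, 0 < K ∧ ∃ K' : ℝ, 0 < K' ∧
      ∀ (𝒳 : Type*) [MeasurableSpace 𝒳]
        (P : Measure (𝒳 × Fin 2)) [IsProbabilityMeasure P]
        (𝒞 : Set (Set 𝒳)) (η : 𝒳 → ℝ),
        𝒞.Countable →
        (∀ C ∈ 𝒞, MeasurableSet C) →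
        BinaryClassification.IsRegressionFunction P η →
        BinaryClassification.bayesSet η ∈ 𝒞 →
        BinaryClassification.MarginCondition P 𝒞 (BinaryClassification.bayesSet η) c →
        BinaryClassification.EntropyBound P.fst 𝒞 L α →
        ∀ (n : ℕ), 1 ≤ n → ∀ (r : ℝ), K * (n : ℝ) ^ (-1 / (α + 1)) ≤ r ^ 2 →
        ∀ (Ω : Type*) [MeasurableSpace Ω] (μ : Measure Ω) [IsProbabilityMeasure μ]
          (Z : Fin n → Ω → 𝒳 × Fin 2),
          (∀ i, Measurable (Z i)) →
          (∀ i, μ.map (Z i) = P) →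
          iIndepFun Z μ →
          ∀ (Chat : Ω → Set 𝒳),
            (∀ ω, BinaryClassification.IsERM 𝒞 (fun i => Z i ω) (Chat ω)) →
            μ.real {ω | r ^ 2 ≤ BinaryClassification.excessRisk P 𝒞 (Chat ω)}
              ≤ K' * Real.exp (-(n * r ^ 2) / K') := by
  classical
  obtain ⟨t, ht0, ht1, ht⟩ : ∃ t : ℝ, 0 < t ∧ t ≤ 1 ∧ t * (1 / c + 1 / 2) ≤ 1 / 4 := by
    have hc' : 0 < 1 / c := by positivity
    refine ⟨1 / (4 * (1 / c + 1)), by positivity, ?_, ?_⟩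
    · rw [div_le_one (by positivity)]; linarith
    · rw [one_div_mul_eq_div, div_le_iff₀ (by positivity)]; linarith
  -- After the union bound the exponent is `-n t s / 8`, whence `K' = 8 / t`; it exceeds one since
  -- `t ≤ 1`.
  refine ⟨(8 * L * 2 ^ α / t) ^ (1 / (α + 1)), by positivity, 8 / t, by positivity, ?_⟩
  intro 𝒳 _ P _ 𝒞 η _ hmeas _ h₀ hmargin hent n hn r hr Ω _ μ _ Z hZ hlaw hind Chat herm
  obtain ⟨hs, hdom⟩ := BinaryClassification.entropy_le_of_critical hα hL ht0 hn hr
  obtain ⟨B, hcard, hB, hcov⟩ := hent.exists_finset (half_pos hs)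
  have hexc := hmargin.excessRisk_eq hc hmeas h₀
  set C₀ := BinaryClassification.bayesSet η
  -- Only brackets holding some bad classifier matter. The family is deterministic, so the union
  -- bound needs no measurability of `Chat`.
  let B' := B.filter fun b => ∃ C ∈ 𝒞, r ^ 2 ≤ BinaryClassification.excessRisk P 𝒞 C ∧
    (∀ x, b.1 x ≤ C.indicator (fun _ => (1 : ℝ)) x) ∧
    (∀ x, C.indicator (fun _ => (1 : ℝ)) x ≤ b.2 x)
  have hsub : {ω | r ^ 2 ≤ BinaryClassification.excessRisk P 𝒞 (Chat ω)} ⊆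
      ⋃ b ∈ B', {ω | ∑ i, BinaryClassification.lowerLoss b C₀ (Z i ω) ≤ 0} := by
    intro ω hω
    obtain ⟨b, hb, h1, h2⟩ := hcov _ (herm ω).1
    refine Set.mem_biUnion (x := b)
      (Finset.mem_filter.mpr ⟨hb, Chat ω, (herm ω).1, hω, h1, h2⟩) ?_
    calc ∑ i, BinaryClassification.lowerLoss b C₀ (Z i ω)
        ≤ ∑ i, (BinaryClassification.loss (Chat ω) (Z i ω)
            - BinaryClassification.loss C₀ (Z i ω)) :=
          Finset.sum_le_sum fun i _ => BinaryClassification.lowerLoss_le h1 h2 C₀ _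
      _ ≤ 0 := by
          rw [Finset.sum_sub_distrib, sub_nonpos]
          exact (herm ω).sum_loss_le hn h₀
  have hone : ∀ b ∈ B', μ.real {ω | ∑ i, BinaryClassification.lowerLoss b C₀ (Z i ω) ≤ 0} ≤
      Real.exp (-(n * (t * r ^ 2 / 4))) := by
    intro b hb
    obtain ⟨hbB, C, hC, hrC, h1, h2⟩ := Finset.mem_filter.mp hb
    have hmC := hmargin C hC
    rw [hexc] at hrC hmC
    exact BinaryClassification.measureReal_sum_lowerLoss_nonpos_le hZ hlaw hind (hmeas C hC)
      (hmeas _ h₀) hc (hB b hbB) h1 h2 hrC hmC ht0.le ht1 ht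
  calc μ.real {ω | r ^ 2 ≤ BinaryClassification.excessRisk P 𝒞 (Chat ω)}
      ≤ μ.real (⋃ b ∈ B', {ω | ∑ i, BinaryClassification.lowerLoss b C₀ (Z i ω) ≤ 0}) :=
        measureReal_mono hsub (measure_ne_top _ _)
    _ ≤ ∑ b ∈ B', μ.real {ω | ∑ i, BinaryClassification.lowerLoss b C₀ (Z i ω) ≤ 0} :=
        measureReal_biUnion_finset_le _ _
    _ ≤ ∑ _b ∈ B', Real.exp (-(n * (t * r ^ 2 / 4))) := Finset.sum_le_sum hone
    _ = B'.card * Real.exp (-(n * (t * r ^ 2 / 4))) := by rw [Finset.sum_const, nsmul_eq_mul]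
    _ ≤ Real.exp (n * (t * r ^ 2 / 8)) * Real.exp (-(n * (t * r ^ 2 / 4))) := by
        refine mul_le_mul_of_nonneg_right ?_ (Real.exp_pos _).le
        calc (B'.card : ℝ) ≤ B.card := by exact_mod_cast Finset.card_filter_le _ _
          _ ≤ _ := hcard.trans (Real.exp_le_exp.mpr hdom)
    _ = Real.exp (-(n * r ^ 2) / (8 / t)) := by
        rw [← Real.exp_add]
        congr 1
        field_simp
        ring
    _ ≤ 8 / t * Real.exp (-(n * r ^ 2) / (8 / t)) := by
        refine le_mul_of_one_le_left (Real.exp_pos _).le ?_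
        rw [le_div_iff₀ ht0]
        linarith
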